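/- Proposition (Semi-algebraic Sets are Definable). A subset $X\subseteq\mathbb{R}^n$ is called semi-algebraic if it is of the form $X=\bigcup_{i=1}^{p}\bigcap_{j=1}^{q}X_{ij}$, where each $X_{ij}$ is of the form $\{x\in\mathbb{R}^n : f_{ij}(x)=0\}$ or $\{x\in\mathbb{R}^n : f_{ij}(x)>0\}$ with $f_{ij}$ a real polynomial in $n$ variables. For each $n\ge 0$ let $\mathcal{O}_n$ be the collection of all semi-algebraic subsets of $\mathbb{R}^n$. Then $\{\mathcal{O}_n\}_{n\ge 0}$ is an o-minimal structure on $\mathbb{R}$, that is: 1. for every $n\ge 0$, $\varnothing\in\mathcal{O}_n$, and $\mathcal{O}_n$ is closed under (finite) unions and under complements in $\mathbb{R}^n$; 2. if $A\in\mathcal{O}_n$, then $A\times\mathbb{R}$ and $\mathbb{R}\times A$ are both in $\mathcal{O}_{n+1}$; 3. for all $n$ and all $1\le i\le j\le n$, the set $\{(x_1,\dots,x_n)\in\mathbb{R}^n : x_i=x_j\}$ is in $\mathcal{O}_n$; 4. if $A\in\mathcal{O}_{n+1}$, then $\pi(A)\in\mathcal{O}_n$, where $\pi:\mathbb{R}^{n+1}\to\mathbb{R}^n$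 is the projection onto the first $n$ coordinates; 5. $\{x\}\in\mathcal{O}_1$ for each $x\in\mathbb{R}$, and $\{(x,y)\in\mathbb{R}^2 : x<y\}\in\mathcal{O}_2$; 6. the sets in $\mathcal{O}_1$ are exactly the finite unions of points and (bounded or unbounded) open intervals of $\mathbb{R}$. -/

import Mathlib

/-- A set of `ℝⁿ` cut out by one polynomial condition `f = 0` or `f > 0`. -/
def IsPolynomialCondition {n : ℕ} (S : Set (Fin n → ℝ)) : Prop :=
  ∃ f : MvPolynomial (Fin n) ℝ,
    S = {x | MvPolynomial.eval x f = 0} ∨ S = {x | 0 < MvPolynomial.eval x f}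

/-- Semi-algebraic subsets of `ℝⁿ`: finite unions of finite intersections of sets given by one
polynomial equation or one strict polynomial inequality. -/
def IsSemialgebraic {n : ℕ} (X : Set (Fin n → ℝ)) : Prop :=
  ∃ (p q : ℕ) (S : Fin p → Fin q → Set (Fin n → ℝ)),
    (∀ i j, IsPolynomialCondition (S i j)) ∧ X = ⋃ i, ⋂ j, S i j

/-- Open intervals of `ℝ`, bounded or unbounded. -/
def IsOpenInterval (I : Set ℝ) : Prop :=
  (∃ a b : ℝ, I = Set.Ioo a b) ∨ (∃ a : ℝ, I = Set.Ioi a) ∨ (∃ b : ℝ, I = Set.Iio b) ∨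
    I = Set.univ

/-- Finite unions of points and open intervals of `ℝ`. -/
def IsFiniteUnionOfPointsAndOpenIntervals (A : Set ℝ) : Prop :=
  ∃ (k : ℕ) (J : Fin k → Set ℝ),
    (∀ i, (∃ a : ℝ, J i = {a}) ∨ IsOpenInterval (J i)) ∧ A = ⋃ i, J i

/-- A sequence `O n` of collections of subsets of `ℝⁿ` is an o-minimal structure on `ℝ`.
`Fin.init` drops the last coordinate and `Fin.tail` drops the first one. -/
structure IsOMinimalStructure (O : (n : ℕ) → Set (Set (Fin n → ℝ))) : Prop where
  empty_mem : ∀ n : ℕ, (∅ : Set (Fin n → ℝ)) ∈ O n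
  union_mem : ∀ (n : ℕ) (A B : Set (Fin n → ℝ)), A ∈ O n → B ∈ O n → A ∪ B ∈ O n
  compl_mem : ∀ (n : ℕ) (A : Set (Fin n → ℝ)), A ∈ O n → Aᶜ ∈ O n
  /-- `A × ℝ` -/
  prod_right_mem : ∀ (n : ℕ) (A : Set (Fin n → ℝ)), A ∈ O n →
    {x : Fin (n + 1) → ℝ | (Fin.init x : Fin n → ℝ) ∈ A} ∈ O (n + 1)
  /-- `ℝ × A` -/
  prod_left_mem : ∀ (n : ℕ) (A : Set (Fin n → ℝ)), A ∈ O n →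
    {x : Fin (n + 1) → ℝ | (Fin.tail x : Fin n → ℝ) ∈ A} ∈ O (n + 1)
  diagonal_mem : ∀ (n : ℕ) (i j : Fin n), i ≤ j → {x : Fin n → ℝ | x i = x j} ∈ O n
  /-- closure under the projection onto the first `n` coordinates -/
  projection_mem : ∀ (n : ℕ) (A : Set (Fin (n + 1) → ℝ)), A ∈ O (n + 1) →
    (fun x : Fin (n + 1) → ℝ => (Fin.init x : Fin n → ℝ)) '' A ∈ O n
  point_mem : ∀ a : ℝ, ({fun _ => a} : Set (Fin 1 → ℝ)) ∈ O 1
  lt_mem : {v : Fin 2 → ℝ | v 0 < v 1} ∈ O 2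
  /-- the members of `O 1`, under `ℝ¹ = ℝ`, are exactly the finite unions -/
  mem_one_iff : ∀ A : Set (Fin 1 → ℝ), A ∈ O 1 ↔
    IsFiniteUnionOfPointsAndOpenIntervals {t : ℝ | (fun _ => t) ∈ A}

open Polynomial

/-! A set is semi-algebraic exactly when membership depends only on the signs of finitely many
polynomials (`isSemialgebraic_iff`). In this form Boolean operations and substitutions of
coordinates are immediate; the deep point is projection (Tarski–Seidenberg).

For it, regard the polynomials as polynomials in the last variable over the ring R of polynomials in
the others. `signDetermined` supplies finitely many elements of R whose signs at a base point
determine the sign pattern along the fibre up to an order automorphism of ℝ. If a and b agree on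
these signs, the automorphism carries a point of A over a to a point of A over b, so the projection
is again described by signs.

`signDetermined` is an induction on degree in the spirit of Cohen and Hörmander. For f of top
degree, one controls f without its leading term, the derivative of f, and pseudo-remainders of f by
truncations of the derivative and of the other members: all have smaller degree. At a root of the
divisor, f has the sign of its remainder. Between critical points f is strictly monotone, so its
signs there and near ±∞ locate its roots among those of the others, and the automorphism can be
corrected at the roots of f without moving the other roots' images
(`exists_orderIso_matching_signs`).

In dimension one, signs are constant between consecutive roots, which gives points and open
intervals. -/

/-! ### Extending finite monotone maps to order automorphisms of the line -/

theorem exists_orderIso_move_up {a b u v : ℝ} (hau : a < u) (huv : u ≤ v) (hvb : v < b) :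
    ∃ k : ℝ ≃o ℝ, k u = v ∧ ∀ y, y ∉ Set.Ioo a b → k y = y := by
  have hs : 0 < (v - a) / (u - a) := by apply div_pos <;> linarith
  have hs1 : 1 ≤ (v - a) / (u - a) := by rw [le_div_iff₀ (by linarith)]; linarith
  have ht : 0 < (b - v) / (b - u) := by apply div_pos <;> linarith
  have ht1 : (b - v) / (b - u) ≤ 1 := by rw [div_le_one (by linarith)]; linarith
  have hsu : (v - a) / (u - a) * (u - a) = v - a := div_mul_cancel₀ _ (by linarith)
  have htu : (b - v) / (b - u) * (b - u) = b - v := div_mul_cancel₀ _ (by linarith)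
  set s := (v - a) / (u - a)
  set t := (b - v) / (b - u)
  -- The two lines pass through (a, a) and (b, b), with slopes s ≥ 1 and t ≤ 1, and both send u to
  -- v. Outside (a, b) one of them is at most the identity, so the maximum is y.
  let k : ℝ → ℝ := fun y => max y (min (a + s * (y - a)) (b - t * (b - y)))
  have hmono : StrictMono k := by
    intro x y hxy
    have h1 : a + s * (x - a) < a + s * (y - a) := by nlinarith
    have h2 : b - t * (b - x) < b - t * (b - y) := by nlinarith
    exact max_lt_max hxy (min_lt_min h1 h2)
  have hfix : ∀ y, y ∉ Set.Ioo a b → k y = y := by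
    intro y hy
    apply max_eq_left
    rcases le_or_gt y a with h | h
    · exact (min_le_left _ _).trans (by nlinarith)
    · have : b ≤ y := by by_contra hb; exact hy ⟨h, not_le.mp hb⟩
      exact (min_le_right _ _).trans (by nlinarith)
  have hcont : Continuous k := by fun_prop
  have hsurj : Function.Surjective k := by
    intro y
    have hx1 : k (min y a) = min y a := hfix _ fun h => absurd h.1 (not_lt.mpr (min_le_right _ _))
    have hx2 : k (max y b) = max y b := hfix _ fun h => absurd h.2 (not_lt.mpr (le_max_right _ _))
    have := intermediate_value_Icc ((min_le_left y a).trans (le_max_left y b)) hcont.continuousOn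
    rw [hx1, hx2] at this
    obtain ⟨x, -, hx⟩ := this ⟨min_le_left y a, le_max_left y b⟩
    exact ⟨x, hx⟩
  refine ⟨hmono.orderIsoOfSurjective k hsurj, ?_, hfix⟩
  have : k u = v := by
    simp only [k]
    rw [hsu, htu]
    simp [huv]
  exact this

theorem exists_orderIso_move {a b u v : ℝ} (hu : u ∈ Set.Ioo a b) (hv : v ∈ Set.Ioo a b) :
    ∃ k : ℝ ≃o ℝ, k u = v ∧ ∀ y, y ∉ Set.Ioo a b → k y = y := by
  rcases le_total u v with h | h
  · exact exists_orderIso_move_up hu.1 h hv.2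
  · obtain ⟨k, hk, hfix⟩ := exists_orderIso_move_up hv.1 h hu.2
    refine ⟨k.symm, by rw [← hk]; simp, fun y hy => ?_⟩
    rw [OrderIso.symm_apply_eq]
    exact (hfix y hy).symm

/-- An order automorphism of the line moving `u` to `v` and fixing finitely many points outside
the segment from `u` to `v`. -/
theorem exists_orderIso_move_fixing {u v : ℝ} (W : Finset ℝ) (hW : ∀ w ∈ W, w ∉ Set.uIcc u v) :
    ∃ k : ℝ ≃o ℝ, k u = v ∧ ∀ w ∈ W, k w = w := by
  have hlow : ∃ a, a < min u v ∧ ∀ w ∈ W, w < min u v → w ≤ a := by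
    have h : ∀ᶠ a in nhdsWithin (min u v) (Set.Iio (min u v)),
        a < min u v ∧ ∀ w ∈ W, w < min u v → w ≤ a := by
      refine (eventually_mem_nhdsWithin).and ((Filter.eventually_all_finset W).mpr fun w _ => ?_)
      by_cases hw : w < min u v
      · filter_upwards [Ioo_mem_nhdsLT hw] with a ha _ using ha.1.le
      · exact Filter.Eventually.of_forall fun _ h => absurd h hw
    exact h.exists
  have hhigh : ∃ b, max u v < b ∧ ∀ w ∈ W, max u v < w → b ≤ w := by
    have h : ∀ᶠ b in nhdsWithin (max u v) (Set.Ioi (max u v)),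
        max u v < b ∧ ∀ w ∈ W, max u v < w → b ≤ w := by
      refine (eventually_mem_nhdsWithin).and ((Filter.eventually_all_finset W).mpr fun w _ => ?_)
      by_cases hw : max u v < w
      · filter_upwards [Ioo_mem_nhdsGT hw] with a ha _ using ha.2.le
      · exact Filter.Eventually.of_forall fun _ h => absurd h hw
    exact h.exists
  obtain ⟨a, ha, haW⟩ := hlow
  obtain ⟨b, hb, hbW⟩ := hhigh
  obtain ⟨k, hk, hfix⟩ := exists_orderIso_move (a := a) (b := b) (u := u) (v := v)
    ⟨ha.trans_le (min_le_left _ _), (le_max_left _ _).trans_lt hb⟩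
    ⟨ha.trans_le (min_le_right _ _), (le_max_right _ _).trans_lt hb⟩
  refine ⟨k, hk, fun w hw => hfix w fun hwab => hW w hw ⟨?_, ?_⟩⟩
  · exact not_lt.mp fun h => absurd hwab.1 (not_lt.mpr (haW w hw h))
  · exact not_lt.mp fun h => absurd hwab.2 (not_lt.mpr (hbW w hw h))

/-- A finite order-preserving partial map of the line extends to an order automorphism. -/
theorem exists_orderIso_extending (T : Finset (ℝ × ℝ))
    (hT : ∀ p ∈ T, ∀ q ∈ T, p.1 < q.1 ↔ p.2 < q.2) :
    ∃ h : ℝ ≃o ℝ, ∀ p ∈ T, h p.1 = p.2 := by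
  induction T using Finset.induction_on with
  | empty => exact ⟨OrderIso.refl ℝ, by simp⟩
  | insert p T _ ih =>
    obtain ⟨h, hh⟩ := ih fun p hp q hq =>
      hT p (Finset.mem_insert_of_mem hp) q (Finset.mem_insert_of_mem hq)
    by_cases hp : h p.1 = p.2
    · exact ⟨h, by simpa [hp] using hh⟩
    -- An earlier target w = q.2 = h q.1 lies on the same side of h p.1 as of p.2, since both
    -- comparisons reflect that of q.1 with p.1. So h p.1 can be moved to p.2 past no earlier
    -- target.
    have key : ∀ w ∈ T.image Prod.snd, w ∉ Set.uIcc (h p.1) p.2 := by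
      intro w hw hmem
      obtain ⟨q, hq, rfl⟩ := Finset.mem_image.mp hw
      have h1 := hT p (Finset.mem_insert_self p T) q (Finset.mem_insert_of_mem hq)
      have h2 := hT q (Finset.mem_insert_of_mem hq) p (Finset.mem_insert_self p T)
      have hq' := hh q hq
      rw [← hq'] at hmem h1 h2
      have h3 : h p.1 < h q.1 ↔ p.1 < q.1 := h.lt_iff_lt
      have h4 : h q.1 < h p.1 ↔ q.1 < p.1 := h.lt_iff_lt
      rcases Set.mem_uIcc.mp hmem with ⟨ha, hb⟩ | ⟨ha, hb⟩ <;> grind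
    obtain ⟨k, hk, hfix⟩ := exists_orderIso_move_fixing _ key
    refine ⟨h.trans k, fun q hq => ?_⟩
    rcases Finset.mem_insert.mp hq with rfl | hq
    · exact hk
    · rw [OrderIso.trans_apply, hh q hq]
      exact hfix _ (Finset.mem_image_of_mem _ hq)

/-! ### Matching the roots of two continuous functions -/

/-- `x` and `y` have the same position with respect to the points of `Z` and their images. -/
def SamePosition (Z : Finset ℝ) (h : ℝ ≃o ℝ) (x y : ℝ) : Prop :=
  ∀ z ∈ Z, (z < x ↔ h z < y) ∧ (x < z ↔ y < h z)

theorem SamePosition.symm {Z : Finset ℝ} {h : ℝ ≃o ℝ} {x y : ℝ} (H : SamePosition Z h x y) :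
    SamePosition (Z.image h) h.symm y x := by
  intro w hw
  obtain ⟨z, hz, rfl⟩ := Finset.mem_image.mp hw
  simpa using ⟨(H z hz).1.symm, (H z hz).2.symm⟩

/-- `f` is injective on every closed interval whose interior avoids `Z`. -/
def InjOffPoints (Z : Finset ℝ) (f : ℝ → ℝ) : Prop :=
  ∀ x y, (∀ z ∈ Z, z ∉ Set.Ioo x y) → Set.InjOn f (Set.Icc x y)

theorem mul_neg_of_injOn {f : ℝ → ℝ} {a c b : ℝ} (hac : a < c) (hcb : c < b)
    (hf : Continuous f) (hinj : Set.InjOn f (Set.Icc a b)) (hc : f c = 0) : f a * f b < 0 := by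
  have ha : a ∈ Set.Icc a b := ⟨le_rfl, (hac.trans hcb).le⟩
  have hb : b ∈ Set.Icc a b := ⟨(hac.trans hcb).le, le_rfl⟩
  have hcm : c ∈ Set.Icc a b := ⟨hac.le, hcb.le⟩
  rcases hf.continuousOn.strictMonoOn_of_injOn_Icc' (hac.trans hcb).le hinj with h | h
  · have h1 := h ha hcm hac
    have h2 := h hcm hb hcb
    rw [hc] at h1 h2
    exact mul_neg_of_neg_of_pos h1 h2
  · have h1 := h ha hcm hac
    have h2 := h hcm hb hcb
    rw [hc] at h1 h2
    exact mul_neg_of_pos_of_neg h1 h2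

theorem exists_root_of_mul_neg {f : ℝ → ℝ} {a b : ℝ} (hab : a < b) (hf : Continuous f)
    (h : f a * f b < 0) : ∃ c ∈ Set.Ioo a b, f c = 0 := by
  rcases mul_neg_iff.mp h with ⟨h1, h2⟩ | ⟨h1, h2⟩
  · obtain ⟨c, hc, hc'⟩ := intermediate_value_Ioo' hab.le hf.continuousOn ⟨h2, h1⟩
    exact ⟨c, hc, hc'⟩
  · obtain ⟨c, hc, hc'⟩ := intermediate_value_Ioo hab.le hf.continuousOn ⟨h1, h2⟩
    exact ⟨c, hc, hc'⟩

theorem exists_adjacent (Z : Finset ℝ) {x : ℝ} (hx : x ∉ Z) (hlow : ∃ z ∈ Z, z < x)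
    (hhigh : ∃ z ∈ Z, x < z) :
    ∃ a ∈ Z, ∃ b ∈ Z, a < x ∧ x < b ∧ ∀ z ∈ Z, z ≤ a ∨ b ≤ z := by
  obtain ⟨a, ha, hmax⟩ := (Z.filter (· < x)).exists_max_image id (by simpa [Finset.Nonempty])
  obtain ⟨b, hb, hmin⟩ := (Z.filter (x < ·)).exists_min_image id (by simpa [Finset.Nonempty])
  rw [Finset.mem_filter] at ha hb
  refine ⟨a, ha.1, b, hb.1, ha.2, hb.2, fun z hz => ?_⟩
  rcases lt_trichotomy z x with h | rfl | h
  · exact Or.inl (hmax z (Finset.mem_filter.mpr ⟨hz, h⟩))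
  · exact absurd hz hx
  · exact Or.inr (hmin z (Finset.mem_filter.mpr ⟨hz, h⟩))

/-- A root outside Z lies between adjacent points a, b of Z, where f is strictly monotone and so
changes sign. Then g changes sign between h a and h b and has a root there. -/
theorem exists_matching_root {Z : Finset ℝ} {h : ℝ ≃o ℝ} {f g : ℝ → ℝ} (hf : Continuous f)
    (hg : Continuous g) (hsign : ∀ z ∈ Z, SignType.sign (f z) = SignType.sign (g (h z)))
    (hinj : InjOffPoints Z f) (hbound : ∀ x, f x = 0 → (∃ z ∈ Z, z < x) ∧ ∃ z ∈ Z, x < z)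
    {x : ℝ} (hx : f x = 0) : ∃ y, g y = 0 ∧ SamePosition Z h x y := by
  by_cases hxZ : x ∈ Z
  · refine ⟨h x, ?_, fun z _ => by simp⟩
    have := hsign x hxZ
    rwa [hx, sign_zero, eq_comm, sign_eq_zero_iff] at this
  · obtain ⟨a, ha, b, hb, hax, hxb, hadj⟩ := exists_adjacent Z hxZ (hbound x hx).1 (hbound x hx).2
    have hneg := mul_neg_of_injOn hax hxb hf
      (hinj a b fun z hz hzab => by rcases hadj z hz with h | h <;> grind) hx
    have hneg' : g (h a) * g (h b) < 0 := by
      rw [← sign_eq_neg_one_iff, sign_mul] at hneg ⊢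
      rw [← hsign a ha, ← hsign b hb, hneg]
    obtain ⟨y, ⟨hay, hyb⟩, hy⟩ := exists_root_of_mul_neg (h.lt_iff_lt.mpr (hax.trans hxb)) hg hneg'
    refine ⟨y, hy, fun z hz => ?_⟩
    rcases hadj z hz with h' | h'
    · have := h.monotone h'
      constructor <;> constructor <;> intro <;> linarith
    · have := h.monotone h'
      constructor <;> constructor <;> intro <;> linarith

/-- Roots of `f` and `g` can be matched by an order automorphism agreeing with `h` on `Z`. -/
theorem exists_orderIso_matching_roots {Z : Finset ℝ} {h : ℝ ≃o ℝ} {f g : ℝ → ℝ}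
    (hf : Continuous f) (hg : Continuous g)
    (hsign : ∀ z ∈ Z, SignType.sign (f z) = SignType.sign (g (h z)))
    (hfinj : InjOffPoints Z f) (hginj : InjOffPoints (Z.image h) g)
    (hfbound : ∀ x, f x = 0 → (∃ z ∈ Z, z < x) ∧ ∃ z ∈ Z, x < z)
    (hgbound : ∀ y, g y = 0 → (∃ z ∈ Z, h z < y) ∧ ∃ z ∈ Z, y < h z)
    (hffin : {x | f x = 0}.Finite) (hgfin : {x | g x = 0}.Finite) :
    ∃ k : ℝ ≃o ℝ, (∀ z ∈ Z, k z = h z) ∧ ∀ x, f x = 0 ↔ g (k x) = 0 := by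
  classical
  -- The graph of h over Z, together with all pairs of roots in the same position; injectivity off Z
  -- makes the partners unique.
  let T : Finset (ℝ × ℝ) := Z.image (fun z => (z, h z)) ∪
    (hffin.toFinset ×ˢ hgfin.toFinset).filter (fun p => SamePosition Z h p.1 p.2)
  have hTpos : ∀ p ∈ T, SamePosition Z h p.1 p.2 := by
    intro p hp
    rcases Finset.mem_union.mp hp with hp | hp
    · obtain ⟨z, hz, rfl⟩ := Finset.mem_image.mp hp
      intro w _; simp
    · exact (Finset.mem_filter.mp hp).2
  have hTroot : ∀ p ∈ T, (p.1 ∈ Z ∧ p.2 = h p.1) ∨ (f p.1 = 0 ∧ g p.2 = 0) := by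
    intro p hp
    rcases Finset.mem_union.mp hp with hp | hp
    · obtain ⟨z, hz, rfl⟩ := Finset.mem_image.mp hp
      exact Or.inl ⟨hz, rfl⟩
    · have := (Finset.mem_filter.mp hp).1
      right; simpa using this
  have hT : ∀ p ∈ T, ∀ q ∈ T, p.1 < q.1 ↔ p.2 < q.2 := by
    intro p hp q hq
    rcases hTroot p hp with ⟨hpZ, hp2⟩ | ⟨hp1, hp2⟩
    · rw [hp2]; exact (hTpos q hq p.1 hpZ).1
    rcases hTroot q hq with ⟨hqZ, hq2⟩ | ⟨hq1, hq2⟩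
    · rw [hq2]; exact (hTpos p hp q.1 hqZ).2
    constructor
    · intro hlt
      -- Two distinct roots are separated by a point of Z, and same position transfers this
      -- separation to their partners.
      have hz : ∃ z ∈ Z, z ∈ Set.Ioo p.1 q.1 := by
        by_contra! hno
        exact hlt.ne (hfinj p.1 q.1 hno ⟨le_rfl, hlt.le⟩ ⟨hlt.le, le_rfl⟩ (hp1.trans hq1.symm))
      obtain ⟨z, hz, hz1, hz2⟩ := hz
      exact ((hTpos p hp z hz).2.mp hz1).trans ((hTpos q hq z hz).1.mp hz2)
    · intro hlt
      have hz : ∃ z ∈ Z.image h, z ∈ Set.Ioo p.2 q.2 := by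
        by_contra! hno
        exact hlt.ne (hginj p.2 q.2 hno ⟨le_rfl, hlt.le⟩ ⟨hlt.le, le_rfl⟩ (hp2.trans hq2.symm))
      obtain ⟨w, hw, hz1, hz2⟩ := hz
      obtain ⟨z, hz, rfl⟩ := Finset.mem_image.mp hw
      exact ((hTpos p hp z hz).2.mpr hz1).trans ((hTpos q hq z hz).1.mpr hz2)
  obtain ⟨k, hk⟩ := exists_orderIso_extending T hT
  refine ⟨k, fun z hz => hk (z, h z) (Finset.mem_union_left _ (Finset.mem_image_of_mem _ hz)),
    fun x => ⟨fun hx => ?_, fun hx => ?_⟩⟩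
  · obtain ⟨y, hy, hxy⟩ := exists_matching_root hf hg hsign hfinj hfbound hx
    rw [hk (x, y) (Finset.mem_union_right _ (by simp [hx, hy, hxy]))]
    exact hy
  · obtain ⟨w, hw, hxw⟩ := exists_matching_root (Z := Z.image h) (h := h.symm) hg hf
      (by simpa using fun z hz => (hsign z hz).symm) hginj (by simpa using hgbound) hx
    have hpos : SamePosition Z h w (k x) := by
      have := hxw.symm
      rwa [Finset.image_image, h.symm_symm, show (h.symm ∘ h : ℝ → ℝ) = id by ext; simp,
        Finset.image_id] at this
    have := hk (w, k x) (Finset.mem_union_right _ (by simp [hx, hw, hpos]))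
    rw [← k.injective this]
    exact hw

/-! ### Signs of real polynomials and their derivatives -/

theorem sign_eval_eq_sign_leadingCoeff {p : ℝ[X]} {x : ℝ} (h : ∀ y, p.IsRoot y → y < x) :
    SignType.sign (p.eval x) = SignType.sign p.leadingCoeff := by
  have hp : p ≠ 0 := by
    rintro rfl
    exact lt_irrefl x (h x (by simp))
  rcases lt_or_gt_of_ne (leadingCoeff_ne_zero.mpr hp) with hl | hl
  · rw [sign_neg hl, sign_neg (eval_lt_zero_of_roots_lt_of_leadingCoeff_nonpos h hl.le)]
  · rw [sign_pos hl, sign_pos (zero_lt_eval_of_roots_lt_of_leadingCoeff_nonneg h hl.le)]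

theorem sign_eval_eq_of_lt_roots {p : ℝ[X]} {x : ℝ} (h : ∀ y, p.IsRoot y → x < y) :
    SignType.sign (p.eval x) =
      SignType.sign ((-1 : ℝ) ^ p.natDegree) * SignType.sign p.leadingCoeff := by
  have h' : ∀ y, (p.comp (-X)).IsRoot y → y < -x := by
    intro y hy
    have := h (-y) (by simpa [IsRoot, eval_comp] using hy)
    linarith
  have := sign_eval_eq_sign_leadingCoeff h'
  rw [leadingCoeff_comp (by simp)] at this
  simpa [eval_comp, sign_mul, mul_comm] using this

theorem sign_eq_of_no_root {f : ℝ → ℝ} (hf : Continuous f) {x y : ℝ}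
    (h : ∀ z ∈ Set.uIcc x y, f z ≠ 0) : SignType.sign (f x) = SignType.sign (f y) := by
  have hx := h x Set.left_mem_uIcc
  have hy := h y Set.right_mem_uIcc
  have key : ¬ (f x * f y < 0) := fun hneg => by
    have h0 : (0 : ℝ) ∈ Set.uIcc (f x) (f y) := by
      rw [Set.mem_uIcc]
      rcases mul_neg_iff.mp hneg with h | h
      · exact Or.inr ⟨h.2.le, h.1.le⟩
      · exact Or.inl ⟨h.1.le, h.2.le⟩
    obtain ⟨z, hz, hz0⟩ := intermediate_value_uIcc hf.continuousOn h0
    exact h z hz hz0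
  rcases lt_or_gt_of_ne hx with hx | hx <;> rcases lt_or_gt_of_ne hy with hy | hy
  · rw [sign_neg hx, sign_neg hy]
  · exact absurd (mul_neg_of_neg_of_pos hx hy) key
  · exact absurd (mul_neg_of_pos_of_neg hx hy) key
  · rw [sign_pos hx, sign_pos hy]

theorem finite_setOf_eval_eq_zero {p : ℝ[X]} (hp : p ≠ 0) : {x | p.eval x = 0}.Finite := by
  refine p.roots.toFinset.finite_toSet.subset fun x hx => ?_
  simpa [hp] using hx

/-- Rolle's theorem: two equal values force a critical point strictly between them. -/
theorem injOffPoints_eval {Z : Finset ℝ} {p : ℝ[X]}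
    (hZ : ∀ x, (derivative p).eval x = 0 → x ∈ Z) : InjOffPoints Z (fun x => p.eval x) := by
  intro a b hab
  have key : ∀ x ∈ Set.Icc a b, ∀ y ∈ Set.Icc a b, x < y → p.eval x ≠ p.eval y := by
    intro x hx y hy hxy heq
    obtain ⟨c, hc, hc0⟩ := exists_deriv_eq_zero hxy p.continuous.continuousOn heq
    rw [Polynomial.deriv] at hc0
    exact hab c (hZ c hc0) ⟨hx.1.trans_lt hc.1, hc.2.trans_le hy.2⟩
  intro x hx y hy heq
  rcases lt_trichotomy x y with h | h | h
  · exact absurd heq (key x hx y hy h)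
  · exact h
  · exact absurd heq.symm (key y hy x hx h)

/-- To the left of a root of `p`, the derivative of `p` somewhere has the sign opposite to that
of `p`. -/
theorem exists_derivative_sign {p : ℝ[X]} {x z : ℝ} (hxz : x < z) (hz : p.eval z = 0) :
    ∃ y ∈ Set.Ioo x z, SignType.sign ((derivative p).eval y) = -SignType.sign (p.eval x) := by
  obtain ⟨y, hy, hslope⟩ := exists_deriv_eq_slope (fun t => p.eval t) hxz
    p.continuous.continuousOn p.differentiable.differentiableOn
  refine ⟨y, hy, ?_⟩
  rw [Polynomial.deriv, hz, zero_sub] at hslope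
  rw [hslope, div_eq_mul_inv, sign_mul, Left.sign_neg,
    sign_pos (inv_pos.mpr (sub_pos.mpr hxz)), mul_one]

theorem exists_left_interval {p : ℝ[X]} (hp : p ≠ 0) {x z : ℝ} (hxz : x < z) :
    ∃ a ∈ Set.Ioo x z, ∀ y, a ≤ y → y < z → p.eval y ≠ 0 := by
  have h : ∀ᶠ a in nhdsWithin z (Set.Iio z),
      a ∈ Set.Ioo x z ∧ ∀ w ∈ p.roots.toFinset, w < z → w < a := by
    refine Filter.Eventually.and (Ioo_mem_nhdsLT hxz)
      ((Filter.eventually_all_finset _).mpr fun w _ => ?_)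
    by_cases hw : w < z
    · filter_upwards [Ioo_mem_nhdsLT hw] with a ha _ using ha.1
    · exact Filter.Eventually.of_forall fun _ h => absurd h hw
  obtain ⟨a, ha, ha'⟩ := h.exists
  exact ⟨a, ha, fun y hay hyz hy => absurd (ha' y (by simpa [hp] using hy) hyz) (not_lt.mpr hay)⟩

/-- Right of all roots the sign is that of the leading coefficient. Otherwise, up to the next root z
on the right, the sign of p is constant and opposite to that of the derivative just left of z;
derivative signs correspond under h. -/
theorem sign_eval_eq_of_roots_correspond {p q : ℝ[X]} {h : ℝ ≃o ℝ}
    (hp' : derivative p ≠ 0)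
    (hlead : SignType.sign p.leadingCoeff = SignType.sign q.leadingCoeff)
    (hroot : ∀ x, p.eval x = 0 ↔ q.eval (h x) = 0)
    (hder : ∀ x, SignType.sign ((derivative p).eval x) =
      SignType.sign ((derivative q).eval (h x))) (x : ℝ) :
    SignType.sign (p.eval x) = SignType.sign (q.eval (h x)) := by
  by_cases hx : p.eval x = 0
  · rw [hx, (hroot x).mp hx]
  have hp : p ≠ 0 := by rintro rfl; simp at hx
  by_cases hnext : ∃ z, x < z ∧ p.eval z = 0
  · have hfin : {z | x < z ∧ p.eval z = 0}.Finite :=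
      (finite_setOf_eval_eq_zero hp).subset fun _ hz => hz.2
    obtain ⟨z, ⟨hxz, hz⟩, hmin⟩ := hfin.exists_minimal hnext
    have hno : ∀ y, x ≤ y → y < z → p.eval y ≠ 0 := by
      intro y hxy hyz hy
      rcases hxy.eq_or_lt with rfl | hxy
      · exact hx hy
      · exact absurd (hmin ⟨hxy, hy⟩ hyz.le) (not_le.mpr hyz)
    have hnoq : ∀ y, h x ≤ y → y < h z → q.eval y ≠ 0 := by
      intro y hxy hyz hy
      refine hno (h.symm y) (h.le_symm_apply.mpr hxy) (h.symm_apply_lt.mpr hyz) ?_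
      rw [hroot]; simpa using hy
    obtain ⟨a, ⟨hxa, haz⟩, ha⟩ := exists_left_interval hp' hxz
    obtain ⟨y, hy, hysign⟩ := exists_derivative_sign haz hz
    obtain ⟨w, hw, hwsign⟩ := exists_derivative_sign (p := q) (h.lt_iff_lt.mpr haz) ((hroot z).mp hz)
    have hw' : h.symm w ∈ Set.Ioo a z := ⟨h.lt_symm_apply.mpr hw.1, h.symm_apply_lt.mpr hw.2⟩
    have h1 : SignType.sign (p.eval x) = SignType.sign (p.eval a) :=
      sign_eq_of_no_root p.continuous fun t ht => by
        rw [Set.uIcc_of_le hxa.le] at ht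
        exact hno t ht.1 (ht.2.trans_lt haz)
    have h2 : SignType.sign (q.eval (h x)) = SignType.sign (q.eval (h a)) :=
      sign_eq_of_no_root q.continuous fun t ht => by
        rw [Set.uIcc_of_le (h.monotone hxa.le)] at ht
        exact hnoq t ht.1 (ht.2.trans_lt (h.lt_iff_lt.mpr haz))
    -- The mean value points y for p and w for q need not correspond under h; the derivative of p
    -- has constant sign on [a, z), so this does no harm.
    have h3 : SignType.sign ((derivative p).eval y) =
        SignType.sign ((derivative p).eval (h.symm w)) :=
      sign_eq_of_no_root (derivative p).continuous fun t ht => by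
        have := Set.uIcc_subset_Icc (Set.Ioo_subset_Icc_self hy) (Set.Ioo_subset_Icc_self hw') ht
        refine ha t this.1 (lt_of_le_of_ne this.2 fun htz => ?_)
        rcases Set.mem_uIcc.mp ht with h | h
        · exact absurd (h.2.trans_lt hw'.2) (by simp [htz])
        · exact absurd (h.2.trans_lt hy.2) (by simp [htz])
    rw [hder (h.symm w), h.apply_symm_apply, hysign, hwsign] at h3
    rw [h1, h2]
    exact neg_injective h3
  · push Not at hnext
    have h1 : SignType.sign (p.eval x) = SignType.sign p.leadingCoeff :=
      sign_eval_eq_sign_leadingCoeff fun y hy => by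
        rcases lt_trichotomy y x with h | rfl | h
        · exact h
        · exact absurd hy hx
        · exact absurd hy (hnext y h)
    have h2 : SignType.sign (q.eval (h x)) = SignType.sign q.leadingCoeff :=
      sign_eval_eq_sign_leadingCoeff fun y hy => by
        have hy' : p.eval (h.symm y) = 0 := by rw [hroot]; simpa using hy
        rw [← h.symm_apply_lt]
        rcases lt_trichotomy (h.symm y) x with h | h | h
        · exact h
        · exact absurd (h ▸ hy') hx
        · exact absurd hy' (hnext _ h)
    rw [h1, h2, hlead]

/-- Two order isomorphisms that agree on a finite set containing the roots of `p` transport the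
sign of `p` equally well. -/
theorem sign_eval_eq_of_agree_on_roots {Z : Finset ℝ} {h k : ℝ ≃o ℝ} {p q : ℝ[X]}
    (hk : ∀ z ∈ Z, k z = h z) (hZ : p ≠ 0 → ∀ x, p.eval x = 0 → x ∈ Z)
    (hsign : ∀ x, SignType.sign (p.eval x) = SignType.sign (q.eval (h x))) (x : ℝ) :
    SignType.sign (p.eval x) = SignType.sign (q.eval (k x)) := by
  by_cases hp : p = 0
  · have := hsign (h.symm (k x))
    simpa [hp] using this
  by_cases hx : p.eval x = 0
  · rw [hsign x, hk x (hZ hp x hx)]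
  rw [hsign x]
  -- A root of q between h x and k x is the common image under h and k of a root z of p;
  -- monotonicity of both maps then forces x = z.
  refine sign_eq_of_no_root q.continuous fun y hy hy0 => hx ?_
  have hz : p.eval (h.symm y) = 0 := by
    rw [← sign_eq_zero_iff, hsign, h.apply_symm_apply, hy0, sign_zero]
  have hzZ := hZ hp _ hz
  have hkz := hk _ hzZ
  rw [h.apply_symm_apply] at hkz
  set z := h.symm y with hzdef
  have hyz : y = h z := by simp [hzdef]
  have hxz : x = z := by
    rcases Set.mem_uIcc.mp hy with ⟨h1, h2⟩ | ⟨h1, h2⟩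
    · rw [hyz, h.le_iff_le] at h1
      rw [← hkz, k.le_iff_le] at h2
      exact le_antisymm h1 h2
    · rw [hyz, h.le_iff_le] at h2
      rw [← hkz, k.le_iff_le] at h1
      exact le_antisymm h1 h2
  rw [hxz, hz]

/-- The inductive step of sign matching: order isomorphisms matching the signs of the derivatives
of `p` and `q`, and the signs of `p` and `q` at finitely many points including the critical ones,
can be modified to match the signs of `p` and `q`. -/
theorem exists_orderIso_matching_signs {Z : Finset ℝ} {h : ℝ ≃o ℝ} {p q : ℝ[X]}
    (hpdeg : 0 < p.natDegree) (hdeg : p.natDegree = q.natDegree)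
    (hlead : SignType.sign p.leadingCoeff = SignType.sign q.leadingCoeff)
    (hZ : ∀ x, (derivative p).eval x = 0 → x ∈ Z)
    (hder : ∀ x, SignType.sign ((derivative p).eval x) =
      SignType.sign ((derivative q).eval (h x)))
    (hsign : ∀ z ∈ Z, SignType.sign (p.eval z) = SignType.sign (q.eval (h z))) :
    ∃ k : ℝ ≃o ℝ, (∀ z ∈ Z, k z = h z) ∧
      ∀ x, SignType.sign (p.eval x) = SignType.sign (q.eval (k x)) := by
  classical
  have hp : p ≠ 0 := by rintro rfl; simp at hpdeg
  have hq : q ≠ 0 := by rintro rfl; simp [hpdeg.ne'] at hdeg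
  have hp' : derivative p ≠ 0 := fun h0 =>
    hpdeg.ne' (derivative_eq_zero.mp h0)
  -- Points a and b beyond W on either side lie beyond all roots of p, and their images beyond all
  -- roots of q. The signs there depend only on the leading coefficient and the parity of the
  -- degree.
  let W : Finset ℝ := p.roots.toFinset ∪ q.roots.toFinset.image h.symm
  obtain ⟨b, hb⟩ : ∃ b, ∀ w ∈ W, w < b := by
    obtain ⟨b, hb⟩ := W.bddAbove
    exact ⟨b + 1, fun w hw => (hb hw).trans_lt (lt_add_one b)⟩
  obtain ⟨a, ha⟩ : ∃ a, ∀ w ∈ W, a < w := by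
    obtain ⟨a, ha⟩ := W.bddBelow
    exact ⟨a - 1, fun w hw => (sub_one_lt a).trans_le (ha hw)⟩
  have hWp : ∀ x, p.eval x = 0 → x ∈ W := fun x hx =>
    Finset.mem_union_left _ (by simpa [hp] using hx)
  have hWq : ∀ x, q.eval x = 0 → h.symm x ∈ W := fun x hx =>
    Finset.mem_union_right _ (Finset.mem_image_of_mem _ (by simpa [hq] using hx))
  have hsa : SignType.sign (p.eval a) = SignType.sign (q.eval (h a)) := by
    rw [sign_eval_eq_of_lt_roots fun y hy => ha y (hWp y hy),
      sign_eval_eq_of_lt_roots fun y hy => h.lt_symm_apply.mp (ha _ (hWq y hy)), hdeg, hlead]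
  have hsb : SignType.sign (p.eval b) = SignType.sign (q.eval (h b)) := by
    rw [sign_eval_eq_sign_leadingCoeff fun y hy => hb y (hWp y hy),
      sign_eval_eq_sign_leadingCoeff fun y hy => h.symm_apply_lt.mp (hb _ (hWq y hy)), hlead]
  let Z' : Finset ℝ := insert a (insert b Z)
  have haZ : a ∈ Z' := by simp [Z']
  have hbZ : b ∈ Z' := by simp [Z']
  have hZZ : Z ⊆ Z' := fun z hz => by simp [Z', hz]
  obtain ⟨k, hk, hroot⟩ := exists_orderIso_matching_roots (Z := Z') (h := h)
    (f := fun x => p.eval x) (g := fun x => q.eval x) p.continuous q.continuous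
    (by
      intro z hz
      simp only [Z', Finset.mem_insert] at hz
      rcases hz with rfl | rfl | hz
      · exact hsa
      · exact hsb
      · exact hsign z hz)
    (injOffPoints_eval fun x hx => hZZ (hZ x hx))
    (injOffPoints_eval fun y hy => by
      refine Finset.mem_image.mpr ⟨h.symm y, hZZ (hZ _ ?_), h.apply_symm_apply y⟩
      rw [← sign_eq_zero_iff, hder, h.apply_symm_apply, hy, sign_zero])
    (fun x hx => ⟨⟨a, haZ, ha x (hWp x hx)⟩, ⟨b, hbZ, hb x (hWp x hx)⟩⟩)
    (fun y hy => ⟨⟨a, haZ, h.lt_symm_apply.mp (ha _ (hWq y hy))⟩,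
      ⟨b, hbZ, h.symm_apply_lt.mp (hb _ (hWq y hy))⟩⟩)
    (finite_setOf_eval_eq_zero hp) (finite_setOf_eval_eq_zero hq)
  refine ⟨k, fun z hz => hk z (hZZ hz), sign_eval_eq_of_roots_correspond hp' hlead hroot ?_⟩
  exact sign_eval_eq_of_agree_on_roots (fun z hz => hk z (hZZ hz)) (fun _ => hZ) hder

/-! ### Pseudo-division and truncation -/

/-- Division with remainder by `g`, after multiplication with an even power of its leading
coefficient. -/
theorem exists_pseudoRemainder {R : Type*} [CommRing R] (f g : R[X]) :
    ∃ (k : ℕ) (q r : R[X]), C (g.leadingCoeff ^ (2 * k)) * f = q * g + r ∧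
      (r = 0 ∨ r.degree < g.degree) := by
  by_cases hg : g = 0
  -- The exponent must be positive here, so that the zero leading coefficient kills f.
  · exact ⟨1, 0, 0, by simp [hg], Or.inl rfl⟩
  induction hn : f.natDegree using Nat.strong_induction_on generalizing f with
  | _ n ih =>
    by_cases hlt : f.degree < g.degree
    · exact ⟨0, 0, f, by simp, Or.inr hlt⟩
    have hle : g.natDegree ≤ f.natDegree := natDegree_le_natDegree (not_lt.mp hlt)
    set c := g.leadingCoeff
    set t := C (c * f.leadingCoeff) * X ^ (f.natDegree - g.natDegree)
    set f₁ := C (c ^ 2) * f - t * g with hf₁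
    have hcoeff : f₁.coeff f.natDegree = 0 := by
      have : (t * g).coeff f.natDegree = c * f.leadingCoeff * c := by
        rw [mul_assoc, coeff_C_mul]
        conv_lhs => rw [← Nat.sub_add_cancel hle, Nat.sub_add_cancel hle, mul_comm (X ^ _) g]
        conv_lhs => rw [← Nat.add_sub_cancel' hle]
        rw [Nat.add_sub_cancel_left, coeff_mul_X_pow]
        rfl
      rw [hf₁, coeff_sub, this, coeff_C_mul, coeff_natDegree]
      ring
    have hdeg : f₁.natDegree ≤ f.natDegree := by
      refine (natDegree_sub_le _ _).trans (max_le (natDegree_C_mul_le _ _) ?_)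
      refine natDegree_mul_le.trans ?_
      have : t.natDegree ≤ f.natDegree - g.natDegree := natDegree_C_mul_X_pow_le _ _
      omega
    have hdone : ∃ (k : ℕ) (q r : R[X]), C (c ^ (2 * k)) * f₁ = q * g + r ∧
        (r = 0 ∨ r.degree < g.degree) := by
      rcases hdeg.eq_or_lt with h | h
      · have h0 : f₁ = 0 := by rwa [← leadingCoeff_eq_zero, leadingCoeff, h]
        exact ⟨0, 0, 0, by simp [h0], Or.inl rfl⟩
      · exact ih _ (hn ▸ h) f₁ rfl
    obtain ⟨k, q, r, hqr, hr⟩ := hdone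
    refine ⟨k + 1, q + C (c ^ (2 * k)) * t, r, ?_, hr⟩
    have : C (c ^ (2 * (k + 1))) * f = C (c ^ (2 * k)) * f₁ + C (c ^ (2 * k)) * t * g := by
      rw [hf₁, mul_add 2 k 1, pow_add, C_mul]; ring
    rw [this, hqr]; ring

noncomputable section

/-- A remainder as in `exists_pseudoRemainder`. -/
def pseudoRemainder {R : Type*} [CommRing R] (f g : R[X]) : R[X] :=
  (exists_pseudoRemainder f g).choose_spec.choose_spec.choose

theorem degree_pseudoRemainder_lt {R : Type*} [CommRing R] (f g : R[X]) {d : ℕ}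
    (hg : g.degree ≤ d) : (pseudoRemainder f g).degree < d := by
  rcases (exists_pseudoRemainder f g).choose_spec.choose_spec.choose_spec.2 with h | h
  · rw [pseudoRemainder, h, degree_zero]; exact WithBot.bot_lt_coe d
  · exact h.trans_le hg

/-- At a root of g the division identity reads c²ᵏ f = r, and the even power of the nonzero c is
positive. -/
theorem sign_eval_pseudoRemainder {R : Type*} [CommRing R] (f g : R[X]) (φ : R →+* ℝ) {x : ℝ}
    (hlead : φ g.leadingCoeff ≠ 0) (hx : (g.map φ).eval x = 0) :
    SignType.sign ((f.map φ).eval x) = SignType.sign (((pseudoRemainder f g).map φ).eval x) := by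
  obtain ⟨k, q, h⟩ : ∃ (k : ℕ) (q : R[X]),
      C (g.leadingCoeff ^ (2 * k)) * f = q * g + pseudoRemainder f g :=
    ⟨_, _, (exists_pseudoRemainder f g).choose_spec.choose_spec.choose_spec.1⟩
  have := congrArg (fun p => (p.map φ).eval x) h
  simp only [Polynomial.map_mul, Polynomial.map_add, eval_mul, eval_add, hx, mul_zero, zero_add,
    map_pow, Polynomial.map_pow, eval_pow, map_C, eval_C] at this
  have hpos : 0 < φ g.leadingCoeff ^ (2 * k) := by rw [pow_mul]; positivity
  rw [← this, sign_mul, sign_pos hpos, one_mul]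

/-- The part of `f` of degree at most `k`. -/
def lowPart {R : Type*} [CommRing R] (k : ℕ) (f : R[X]) : R[X] :=
  ∑ i ∈ Finset.range (k + 1), monomial i (f.coeff i)

theorem coeff_lowPart {R : Type*} [CommRing R] (k : ℕ) (f : R[X]) (i : ℕ) :
    (lowPart k f).coeff i = if i ≤ k then f.coeff i else 0 := by
  simp [lowPart, coeff_monomial]

theorem degree_lowPart_le {R : Type*} [CommRing R] (k : ℕ) (f : R[X]) :
    (lowPart k f).degree ≤ f.degree := by
  rw [degree_le_iff_coeff_zero]
  intro m hm
  rw [coeff_lowPart, coeff_eq_zero_of_degree_lt hm, ite_self]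

theorem map_lowPart_eq {R : Type*} [CommRing R] {k : ℕ} {f : R[X]} {φ : R →+* ℝ}
    (h : ∀ i, k < i → φ (f.coeff i) = 0) : (lowPart k f).map φ = f.map φ := by
  ext i
  rw [coeff_map, coeff_map, coeff_lowPart]
  split_ifs with hi
  · rfl
  · rw [h i (not_le.mp hi), map_zero]

theorem leadingCoeff_lowPart {R : Type*} [CommRing R] {k : ℕ} {f : R[X]} (h : f.coeff k ≠ 0) :
    (lowPart k f).leadingCoeff = f.coeff k := by
  have hdeg : (lowPart k f).natDegree = k := by
    apply le_antisymm
    · rw [natDegree_le_iff_coeff_eq_zero]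
      intro m hm
      rw [coeff_lowPart, if_neg (not_le.mpr hm)]
    · exact le_natDegree_of_ne_zero (by rwa [coeff_lowPart, if_pos le_rfl])
  rw [leadingCoeff, hdeg, coeff_lowPart, if_pos le_rfl]

/-! ### Sign patterns of specialized polynomials -/

/-- Specializations of `L` with matching signs of finitely many coefficients have matching sign
behaviour on the line. -/
def SignDetermined {R : Type*} [CommRing R] (L : Finset R[X]) : Prop :=
  ∃ S : Finset R, ∀ φ ψ : R →+* ℝ,
    (∀ c ∈ S, SignType.sign (φ c) = SignType.sign (ψ c)) →
      ∃ h : ℝ ≃o ℝ, ∀ f ∈ L, ∀ x,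
        SignType.sign ((f.map φ).eval x) = SignType.sign ((f.map ψ).eval (h x))

section Step

variable {R : Type*} [CommRing R]

open Classical in
theorem SignDetermined.insert_C {L : Finset R[X]} (h : SignDetermined L) (c : R) :
    SignDetermined (insert (C c) L) := by
  obtain ⟨S, hS⟩ := h
  refine ⟨insert c S, fun φ ψ hφψ => ?_⟩
  obtain ⟨h, hh⟩ := hS φ ψ fun c' hc' => hφψ c' (Finset.mem_insert_of_mem hc')
  refine ⟨h, fun f hf x => ?_⟩
  rcases Finset.mem_insert.mp hf with rfl | hf
  · simpa using hφψ c (Finset.mem_insert_self _ _)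
  · exact hh f hf x

open Classical in
/-- The polynomials of lower degree that control the signs of `f` relative to `L`. -/
def controlSet (f : R[X]) (L : Finset R[X]) : Finset R[X] :=
  {f.eraseLead, derivative f} ∪
    (insert (derivative f) L ×ˢ Finset.range (f.natDegree + 1)).image
      fun p => pseudoRemainder f (lowPart p.2 p.1)

open Classical in
-- The control set gives the signs of f at the roots of L and of its derivative. With the sign of
-- the leading coefficient this suffices to match f, keeping those roots' images and hence the signs
-- of L.
theorem SignDetermined.insert {f : R[X]} {L : Finset R[X]} (hf : 0 < f.natDegree)
    (hL : ∀ g ∈ L, g.natDegree ≤ f.natDegree) (h : SignDetermined (controlSet f L ∪ L)) :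
    SignDetermined (insert f L) := by
  obtain ⟨S, hS⟩ := h
  let G : Finset R[X] := Insert.insert (derivative f) L
  have hGdeg : ∀ g ∈ G, g.natDegree ≤ f.natDegree := by
    intro g hg
    rcases Finset.mem_insert.mp hg with rfl | hg
    · exact (natDegree_derivative_le f).trans (Nat.sub_le _ _)
    · exact hL g hg
  -- Fixing the signs of all coefficients makes the two specializations of each divisor have the
  -- same degree.
  refine ⟨Insert.insert f.leadingCoeff (S ∪ (G ×ˢ Finset.range (f.natDegree + 1)).image
    fun p => p.1.coeff p.2), fun φ ψ hφψ => ?_⟩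
  have hlead : SignType.sign (φ f.leadingCoeff) = SignType.sign (ψ f.leadingCoeff) :=
    hφψ _ (Finset.mem_insert_self _ _)
  have hcoeff : ∀ g ∈ G, ∀ i, SignType.sign (φ (g.coeff i)) = SignType.sign (ψ (g.coeff i)) := by
    intro g hg i
    by_cases hi : i ≤ f.natDegree
    · refine hφψ _ (Finset.mem_insert_of_mem (Finset.mem_union_right _ ?_))
      exact Finset.mem_image.mpr ⟨(g, i), by simp [hg, hi], rfl⟩
    · rw [coeff_eq_zero_of_natDegree_lt ((hGdeg g hg).trans_lt (not_le.mp hi))]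
      simp
  obtain ⟨h, hh⟩ := hS φ ψ fun c hc =>
    hφψ c (Finset.mem_insert_of_mem (Finset.mem_union_left _ hc))
  have hhL : ∀ g ∈ L, ∀ x,
      SignType.sign ((g.map φ).eval x) = SignType.sign ((g.map ψ).eval (h x)) :=
    fun g hg => hh g (Finset.mem_union_right _ hg)
  have hhC : ∀ g ∈ controlSet f L, ∀ x,
      SignType.sign ((g.map φ).eval x) = SignType.sign ((g.map ψ).eval (h x)) :=
    fun g hg => hh g (Finset.mem_union_left _ hg)
  have hder := hhC (derivative f) (by simp [controlSet])
  have hhG : ∀ g ∈ G, ∀ x,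
      SignType.sign ((g.map φ).eval x) = SignType.sign ((g.map ψ).eval (h x)) := by
    intro g hg
    rcases Finset.mem_insert.mp hg with rfl | hg
    · exact hder
    · exact hhL g hg
  by_cases h0 : φ f.leadingCoeff = 0
  · have h0' : ψ f.leadingCoeff = 0 := by rwa [h0, sign_zero, eq_comm, sign_eq_zero_iff] at hlead
    refine ⟨h, fun g hg x => ?_⟩
    rcases Finset.mem_insert.mp hg with rfl | hg
    · have := hhC g.eraseLead (by simp [controlSet]) x
      have hmap : ∀ χ : R →+* ℝ, χ g.leadingCoeff = 0 → g.eraseLead.map χ = g.map χ := by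
        intro χ hχ
        conv_rhs => rw [← g.eraseLead_add_C_mul_X_pow]
        simp only [Polynomial.map_add, Polynomial.map_mul, map_C, hχ, map_zero, zero_mul, add_zero]
      rwa [hmap φ h0, hmap ψ h0'] at this
    · exact hhL g hg x
  have h0' : ψ f.leadingCoeff ≠ 0 := by
    rwa [Ne, ← sign_eq_zero_iff, ← hlead, sign_eq_zero_iff]
  let Z : Finset ℝ := G.biUnion fun g => (g.map φ).roots.toFinset
  have hroots : ∀ g ∈ G, g.map φ ≠ 0 → ∀ x, (g.map φ).eval x = 0 → x ∈ Z := by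
    intro g hg hg0 x hx
    exact Finset.mem_biUnion.mpr ⟨g, hg, by simpa [hg0] using hx⟩
  have hsign : ∀ z ∈ Z,
      SignType.sign ((f.map φ).eval z) = SignType.sign ((f.map ψ).eval (h z)) := by
    intro z hz
    obtain ⟨g, hg, hgz⟩ := Finset.mem_biUnion.mp hz
    rw [Multiset.mem_toFinset, mem_roots'] at hgz
    obtain ⟨hg0, hgz⟩ := hgz
    have hvan : ∀ i, φ (g.coeff i) = 0 ↔ ψ (g.coeff i) = 0 := fun i => by
      rw [← sign_eq_zero_iff, hcoeff g hg i, sign_eq_zero_iff]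
    -- Leading coefficients of g may vanish under φ. Truncating at the true degree k changes neither
    -- specialization and leaves a leading coefficient that survives both, as pseudo-division needs.
    set k := (g.map φ).natDegree with hk
    have hk0 : φ (g.coeff k) ≠ 0 := by
      rw [← coeff_map, hk, coeff_natDegree]
      exact leadingCoeff_ne_zero.mpr hg0
    have hkhigh : ∀ i, k < i → φ (g.coeff i) = 0 := fun i hi => by
      rw [← coeff_map]; exact coeff_eq_zero_of_natDegree_lt hi
    have hlc : (lowPart k g).leadingCoeff = g.coeff k :=
      leadingCoeff_lowPart fun h => hk0 (by rw [h, map_zero])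
    have hkf : k ≤ f.natDegree := natDegree_map_le.trans (hGdeg g hg)
    rw [sign_eval_pseudoRemainder f (lowPart k g) φ (by rwa [hlc])
        (by rw [map_lowPart_eq hkhigh]; exact hgz),
      sign_eval_pseudoRemainder f (lowPart k g) ψ (x := h z)
        (by rwa [hlc, Ne, ← hvan])
        (by
          rw [map_lowPart_eq fun i hi => (hvan i).mp (hkhigh i hi), ← sign_eq_zero_iff,
            ← hhG g hg, sign_eq_zero_iff]
          exact hgz)]
    refine hhC _ (Finset.mem_union_right _ (Finset.mem_image.mpr ⟨(g, k), ?_, rfl⟩)) z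
    exact Finset.mem_product.mpr ⟨hg, Finset.mem_range.mpr (Nat.lt_succ_of_le hkf)⟩
  have hdegφ : (f.map φ).natDegree = f.natDegree := natDegree_map_of_leadingCoeff_ne_zero φ h0
  have hdegψ : (f.map ψ).natDegree = f.natDegree := natDegree_map_of_leadingCoeff_ne_zero ψ h0'
  have hder0 : (derivative f).map φ ≠ 0 := by
    rw [← derivative_map, Ne, derivative_eq_zero, hdegφ]
    exact hf.ne'
  obtain ⟨k, hk, hkf⟩ := exists_orderIso_matching_signs (Z := Z) (h := h) (p := f.map φ)
    (q := f.map ψ) (hdegφ ▸ hf) (hdegφ.trans hdegψ.symm)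
    (by rwa [leadingCoeff_map_of_leadingCoeff_ne_zero φ h0,
      leadingCoeff_map_of_leadingCoeff_ne_zero ψ h0'])
    (by rw [derivative_map]; exact hroots _ (Finset.mem_insert_self _ _) hder0)
    (by simpa only [derivative_map] using hder) hsign
  refine ⟨k, fun g hg => ?_⟩
  rcases Finset.mem_insert.mp hg with rfl | hg
  · exact hkf
  · exact sign_eval_eq_of_agree_on_roots hk (hroots g (Finset.mem_insert_of_mem hg)) (hhL g hg)

open Classical in
-- Inner induction on the members of B, which may have degree d. The set A of lower degree must stay
-- arbitrary, because each step enlarges it by a control set.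
theorem signDetermined_union {d : ℕ}
    (ih : ∀ L : Finset R[X], (∀ f ∈ L, f.degree < d) → SignDetermined L) (B : Finset R[X])
    (hB : ∀ f ∈ B, f.degree ≤ d) (A : Finset R[X]) (hA : ∀ f ∈ A, f.degree < d) :
    SignDetermined (A ∪ B) := by
  induction B using Finset.induction_on generalizing A with
  | empty => simpa using ih A hA
  | insert f B _ ihB =>
    have hB' : ∀ f ∈ B, f.degree ≤ d := fun g hg => hB g (Finset.mem_insert_of_mem hg)
    have hf := hB f (Finset.mem_insert_self _ _)
    rw [Finset.union_insert]
    rcases hf.lt_or_eq with hlt | heq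
    · have := ihB hB' (Insert.insert f A) (by simpa [hlt] using hA)
      rwa [Finset.insert_union] at this
    have hnat : f.natDegree = d := natDegree_eq_of_degree_eq_some heq
    rcases Nat.eq_zero_or_pos d with hd | hd
    · rw [eq_C_of_natDegree_eq_zero (hnat.trans hd)]
      exact (ihB hB' A hA).insert_C _
    have hf0 : f ≠ 0 := by rintro rfl; simp at hnat; omega
    have hder : (derivative f).degree < d := heq ▸ degree_derivative_lt hf0
    have hL : ∀ g ∈ A ∪ B, g.degree ≤ d := fun g hg =>
      (Finset.mem_union.mp hg).elim (fun h => (hA g h).le) (hB' g)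
    refine SignDetermined.insert (hnat ▸ hd)
      (fun g hg => hnat ▸ natDegree_le_of_degree_le (hL g hg)) ?_
    rw [← Finset.union_assoc]
    refine ihB hB' _ fun g hg => ?_
    rcases Finset.mem_union.mp hg with hg | hg
    swap
    · exact hA g hg
    rcases Finset.mem_union.mp hg with hg | hg
    · rcases Finset.mem_insert.mp hg with rfl | hg
      · exact heq ▸ degree_eraseLead_lt hf0
      · rwa [Finset.mem_singleton.mp hg]
    · obtain ⟨⟨g', k⟩, hp, rfl⟩ := Finset.mem_image.mp hg
      refine degree_pseudoRemainder_lt f _ ((degree_lowPart_le _ _).trans ?_)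
      rcases Finset.mem_insert.mp (Finset.mem_product.mp hp).1 with h | h
      · rw [show g' = _ from h]; exact hder.le
      · exact hL g' h

theorem signDetermined (L : Finset R[X]) : SignDetermined L := by
  have key : ∀ d : ℕ, ∀ L : Finset R[X], (∀ f ∈ L, f.degree < d) → SignDetermined L := by
    intro d
    induction d with
    | zero =>
      intro L hL
      refine ⟨∅, fun φ ψ _ => ⟨OrderIso.refl ℝ, fun f hf x => ?_⟩⟩
      have : f = 0 := degree_eq_bot.mp (by simpa using Nat.WithBot.lt_zero_iff.mp (hL f hf))
      simp [this]
    | succ d ih =>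
      intro L hL
      classical
      have hle : ∀ f ∈ L, f.degree ≤ d := fun f hf => by
        rw [degree_le_iff_coeff_zero]
        intro m hm
        refine coeff_eq_zero_of_degree_lt ((hL f hf).trans_le ?_)
        exact_mod_cast Nat.succ_le_of_lt (WithBot.coe_lt_coe.mp hm)
      simpa using signDetermined_union ih L hle ∅ (by simp)
  refine key (L.sup natDegree + 1) L fun f hf => ?_
  refine degree_le_natDegree.trans_lt ?_
  exact_mod_cast Nat.lt_succ_of_le (Finset.le_sup (f := natDegree) hf)

end Step

end

/-! ### Semi-algebraic sets as sign-invariant sets -/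

/-- Points with equal signs of all members of `F` are both in `X` or both outside `X`. -/
def IsSignInvariant {n : ℕ} (F : Finset (MvPolynomial (Fin n) ℝ)) (X : Set (Fin n → ℝ)) : Prop :=
  ∀ x y, (∀ f ∈ F, SignType.sign (MvPolynomial.eval x f) = SignType.sign (MvPolynomial.eval y f)) →
    x ∈ X → y ∈ X

theorem IsSignInvariant.mono {n : ℕ} {F G : Finset (MvPolynomial (Fin n) ℝ)}
    {X : Set (Fin n → ℝ)} (h : IsSignInvariant F X) (hFG : F ⊆ G) : IsSignInvariant G X :=
  fun x y hxy => h x y fun f hf => hxy f (hFG hf)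

theorem isPolynomialCondition_sign_eq {n : ℕ} (f : MvPolynomial (Fin n) ℝ) (s : SignType) :
    IsPolynomialCondition {x | SignType.sign (MvPolynomial.eval x f) = s} := by
  cases s
  · exact ⟨f, Or.inl (by ext x; exact sign_eq_zero_iff)⟩
  · exact ⟨-f, Or.inr (by ext x; simpa using sign_eq_neg_one_iff)⟩
  · exact ⟨f, Or.inr (by ext x; exact sign_eq_one_iff)⟩

theorem isSemialgebraic_iff {n : ℕ} {X : Set (Fin n → ℝ)} :
    IsSemialgebraic X ↔ ∃ F, IsSignInvariant F X := by
  classical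
  constructor
  · rintro ⟨p, q, S, hS, rfl⟩
    choose f hf using hS
    refine ⟨Finset.univ.image fun ij : Fin p × Fin q => f ij.1 ij.2, fun x y hxy hx => ?_⟩
    simp only [Set.mem_iUnion, Set.mem_iInter] at hx ⊢
    obtain ⟨i, hi⟩ := hx
    refine ⟨i, fun j => ?_⟩
    have hs := hxy (f i j) (Finset.mem_image.mpr ⟨(i, j), Finset.mem_univ _, rfl⟩)
    have hij := hi j
    rcases hf i j with h | h <;> rw [h] at hij ⊢
    · rw [Set.mem_ofPred_eq, ← sign_eq_zero_iff] at hij ⊢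
      rw [← hs, hij]
    · rw [Set.mem_ofPred_eq, ← sign_eq_one_iff] at hij ⊢
      rw [← hs, hij]
  · rintro ⟨F, hF⟩
    -- X is the union of the cells of the sign vectors realized on X, of which there are finitely
    -- many.
    let I := {σ : F → SignType //
      ∃ x ∈ X, ∀ f : F, SignType.sign (MvPolynomial.eval x f.1) = σ f}
    obtain ⟨p, ⟨eI⟩⟩ := Finite.exists_equiv_fin I
    obtain ⟨q, ⟨eF⟩⟩ := Finite.exists_equiv_fin F
    refine ⟨p, q, fun i j => {x | SignType.sign (MvPolynomial.eval x (eF.symm j).1) =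
      (eI.symm i).1 (eF.symm j)}, fun i j => isPolynomialCondition_sign_eq _ _, ?_⟩
    ext y
    simp only [Set.mem_iUnion, Set.mem_iInter, Set.mem_ofPred_eq]
    constructor
    · intro hy
      refine ⟨eI ⟨fun f => SignType.sign (MvPolynomial.eval y f.1), y, hy, fun _ => rfl⟩, ?_⟩
      simp
    · rintro ⟨i, hi⟩
      obtain ⟨x, hx, hxs⟩ := (eI.symm i).2
      refine hF x y (fun f hf => ?_) hx
      have := hi (eF ⟨f, hf⟩)
      rw [eF.symm_apply_apply] at this
      rw [hxs ⟨f, hf⟩, this]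

theorem IsSemialgebraic.compl {n : ℕ} {X : Set (Fin n → ℝ)} (h : IsSemialgebraic X) :
    IsSemialgebraic Xᶜ := by
  rw [isSemialgebraic_iff] at h ⊢
  obtain ⟨F, hF⟩ := h
  exact ⟨F, fun x y hxy hx hy => hx (hF y x (fun f hf => (hxy f hf).symm) hy)⟩

theorem IsSemialgebraic.union {n : ℕ} {X Y : Set (Fin n → ℝ)} (hX : IsSemialgebraic X)
    (hY : IsSemialgebraic Y) : IsSemialgebraic (X ∪ Y) := by
  classical
  rw [isSemialgebraic_iff] at hX hY ⊢
  obtain ⟨F, hF⟩ := hX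
  obtain ⟨G, hG⟩ := hY
  exact ⟨F ∪ G, fun x y hxy => Or.imp (hF.mono Finset.subset_union_left x y hxy)
    (hG.mono Finset.subset_union_right x y hxy)⟩

theorem isSemialgebraic_empty (n : ℕ) : IsSemialgebraic (∅ : Set (Fin n → ℝ)) :=
  isSemialgebraic_iff.mpr ⟨∅, fun _ _ _ h => h⟩

theorem IsSemialgebraic.iUnion {n k : ℕ} {X : Fin k → Set (Fin n → ℝ)}
    (h : ∀ i, IsSemialgebraic (X i)) : IsSemialgebraic (⋃ i, X i) := by
  classical
  simp only [isSemialgebraic_iff] at h ⊢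
  choose F hF using h
  refine ⟨Finset.univ.biUnion F, fun x y hxy hx => ?_⟩
  obtain ⟨i, hi⟩ := Set.mem_iUnion.mp hx
  exact Set.mem_iUnion.mpr ⟨i, (hF i).mono
    (Finset.subset_biUnion_of_mem F (Finset.mem_univ i)) x y hxy hi⟩

theorem IsSemialgebraic.inter {n : ℕ} {X Y : Set (Fin n → ℝ)} (hX : IsSemialgebraic X)
    (hY : IsSemialgebraic Y) : IsSemialgebraic (X ∩ Y) := by
  rw [← compl_compl (X ∩ Y), Set.compl_inter]
  exact (hX.compl.union hY.compl).compl

theorem IsPolynomialCondition.isSemialgebraic {n : ℕ} {X : Set (Fin n → ℝ)}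
    (h : IsPolynomialCondition X) : IsSemialgebraic X :=
  ⟨1, 1, fun _ _ => X, fun _ _ => h, by rw [Set.iUnion_const, Set.iInter_const]⟩

theorem isSemialgebraic_of_mem_iff_eq_zero {n : ℕ} {X : Set (Fin n → ℝ)}
    (f : MvPolynomial (Fin n) ℝ) (h : ∀ x, x ∈ X ↔ MvPolynomial.eval x f = 0) :
    IsSemialgebraic X :=
  IsPolynomialCondition.isSemialgebraic ⟨f, Or.inl (Set.ext h)⟩

theorem isSemialgebraic_of_mem_iff_pos {n : ℕ} {X : Set (Fin n → ℝ)}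
    (f : MvPolynomial (Fin n) ℝ) (h : ∀ x, x ∈ X ↔ 0 < MvPolynomial.eval x f) :
    IsSemialgebraic X :=
  IsPolynomialCondition.isSemialgebraic ⟨f, Or.inr (Set.ext h)⟩

/-- Substituting coordinates renames variables; dropping the last or the first coordinate gives the
two products with ℝ. -/
theorem IsSemialgebraic.preimage_comp {m n : ℕ} {X : Set (Fin n → ℝ)} (h : IsSemialgebraic X)
    (e : Fin n → Fin m) : IsSemialgebraic {x : Fin m → ℝ | x ∘ e ∈ X} := by
  classical
  rw [isSemialgebraic_iff] at h ⊢
  obtain ⟨F, hF⟩ := h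
  refine ⟨F.image (MvPolynomial.rename e), fun x y hxy => hF _ _ fun f hf => ?_⟩
  simpa [MvPolynomial.eval_rename] using hxy _ (Finset.mem_image_of_mem _ hf)

/-! ### Projection along the last coordinate -/

noncomputable section

/-- A polynomial in `n + 1` variables as a polynomial in the last one. -/
def toPolynomialLast (n : ℕ) :
    MvPolynomial (Fin (n + 1)) ℝ →ₐ[ℝ] Polynomial (MvPolynomial (Fin n) ℝ) :=
  MvPolynomial.aeval (Fin.snoc (fun i => Polynomial.C (MvPolynomial.X i)) Polynomial.X :
    Fin (n + 1) → Polynomial (MvPolynomial (Fin n) ℝ))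

theorem eval_map_toPolynomialLast {n : ℕ} (a : Fin n → ℝ) (t : ℝ)
    (f : MvPolynomial (Fin (n + 1)) ℝ) :
    ((toPolynomialLast n f).map (MvPolynomial.eval a)).eval t =
      MvPolynomial.eval (Fin.snoc a t : Fin (n + 1) → ℝ) f := by
  induction f using MvPolynomial.induction_on with
  | C r =>
    rw [toPolynomialLast, MvPolynomial.aeval_C, MvPolynomial.eval_C,
      Polynomial.algebraMap_apply, Polynomial.map_C, Polynomial.eval_C,
      MvPolynomial.algebraMap_eq, MvPolynomial.eval_C]
  | add p q hp hq => simp [hp, hq]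
  | mul_X p i hp =>
    rw [map_mul, Polynomial.map_mul, Polynomial.eval_mul, hp, map_mul, MvPolynomial.eval_X,
      toPolynomialLast, MvPolynomial.aeval_X]
    congr 1
    induction i using Fin.lastCases <;> simp

end

theorem IsSemialgebraic.projection {n : ℕ} {A : Set (Fin (n + 1) → ℝ)} (h : IsSemialgebraic A) :
    IsSemialgebraic ((fun x : Fin (n + 1) → ℝ => (Fin.init x : Fin n → ℝ)) '' A) := by
  classical
  rw [isSemialgebraic_iff] at h ⊢
  obtain ⟨F, hF⟩ := h
  obtain ⟨S, hS⟩ := signDetermined (F.image (toPolynomialLast n))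
  refine ⟨S, ?_⟩
  rintro _ b hab ⟨x, hx, rfl⟩
  obtain ⟨h, hh⟩ := hS (MvPolynomial.eval (Fin.init x)) (MvPolynomial.eval b) hab
  refine ⟨Fin.snoc b (h (x (Fin.last n))), hF x _ (fun f hf => ?_) hx, by simp⟩
  have := hh _ (Finset.mem_image_of_mem _ hf) (x (Fin.last n))
  rwa [eval_map_toPolynomialLast, eval_map_toPolynomialLast, Fin.snoc_init_self] at this

/-! ### Semi-algebraic subsets of the line -/

theorem isOpenInterval_of_isOpen_of_ordConnected {I : Set ℝ} (ho : IsOpen I)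
    (hc : I.OrdConnected) : IsOpenInterval I := by
  have hI := hc.isPreconnected.mem_intervals
  rw [← ho.interior_eq]
  simp only [Set.mem_insert_iff, Set.mem_singleton_iff] at hI
  have hempty : IsOpenInterval ∅ := Or.inl ⟨0, 0, by simp⟩
  rcases hI with h | h | h | h | h | h | h | h | h | h <;> rw [h] <;>
    simp only [interior_Icc, interior_Ico, interior_Ioc, interior_Ioo, interior_Ici, interior_Ioi,
      interior_Iic, interior_Iio, interior_univ, interior_empty]
  any_goals exact Or.inl ⟨_, _, rfl⟩
  any_goals exact Or.inr (Or.inl ⟨_, rfl⟩)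
  any_goals exact Or.inr (Or.inr (Or.inl ⟨_, rfl⟩))
  · exact Or.inr (Or.inr (Or.inr rfl))
  · exact hempty

theorem isFiniteUnion_of_finite {J : Set (Set ℝ)} (hfin : J.Finite)
    (hJ : ∀ I ∈ J, (∃ a : ℝ, I = {a}) ∨ IsOpenInterval I) :
    IsFiniteUnionOfPointsAndOpenIntervals (⋃₀ J) := by
  have := hfin.to_subtype
  obtain ⟨k, ⟨e⟩⟩ := Finite.exists_equiv_fin J
  refine ⟨k, fun i => (e.symm i).1, fun i => hJ _ (e.symm i).2, ?_⟩
  rw [Set.sUnion_eq_iUnion]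
  exact (e.symm.surjective.iUnion_comp (fun I : J => I.1)).symm

/-- The points outside `Z` lying above exactly the points of `S`. -/
def cutInterval (Z S : Finset ℝ) : Set ℝ := {y | ∀ z ∈ Z, (z ∈ S → z < y) ∧ (z ∉ S → y < z)}

theorem isOpenInterval_cutInterval (Z S : Finset ℝ) : IsOpenInterval (cutInterval Z S) := by
  apply isOpenInterval_of_isOpen_of_ordConnected
  · have : cutInterval Z S = ⋂ z ∈ Z, if z ∈ S then Set.Ioi z else Set.Iio z := by
      ext y
      simp only [cutInterval, Set.mem_ofPred_eq, Set.mem_iInter]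
      refine forall₂_congr fun z _ => ?_
      split_ifs with h <;> simp [h]
    rw [this]
    refine isOpen_biInter_finset fun z _ => ?_
    split_ifs
    · exact isOpen_Ioi
    · exact isOpen_Iio
  · exact ⟨fun x hx y hy t ht z hz => ⟨fun h => ((hx z hz).1 h).trans_le ht.1,
      fun h => ht.2.trans_lt ((hy z hz).2 h)⟩⟩

/-- A is the union of its points in Z and of the gaps of Z that it contains; a gap is indexed by the
subset of Z below it, so there are finitely many. -/
theorem isFiniteUnion_of_locally_constant (Z : Finset ℝ) (A : Set ℝ)
    (hA : ∀ x y, (∀ z ∈ Z, z ∉ Set.uIcc x y) → x ∈ A → y ∈ A) :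
    IsFiniteUnionOfPointsAndOpenIntervals A := by
  classical
  have hAeq : A = ⋃₀ ((fun a : ℝ => ({a} : Set ℝ)) '' {z | z ∈ Z ∧ z ∈ A} ∪
      (cutInterval Z '' {S | S ∈ Z.powerset ∧ cutInterval Z S ⊆ A})) := by
    ext x
    constructor
    · intro hx
      by_cases hxZ : x ∈ Z
      · exact ⟨{x}, Or.inl ⟨x, ⟨hxZ, hx⟩, rfl⟩, rfl⟩
      · have hmem : x ∈ cutInterval Z (Z.filter (· < x)) := fun z hz => by
          have hne : z ≠ x := fun h => hxZ (h ▸ hz)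
          simp only [Finset.mem_filter, hz, true_and, imp_self, not_lt]
          exact fun h => lt_of_le_of_ne h hne.symm
        refine ⟨_, Or.inr ⟨Z.filter (· < x), ⟨by simp, fun y hy => ?_⟩, rfl⟩, hmem⟩
        refine hA x y (fun z hz hzxy => ?_) hx
        have h1 := hmem z hz
        have h2 := hy z hz
        by_cases hzS : z ∈ Z.filter (· < x)
        · rcases Set.mem_uIcc.mp hzxy with h | h
          · exact absurd (h1.1 hzS) (not_lt.mpr h.1)
          · exact absurd (h2.1 hzS) (not_lt.mpr h.1)
        · rcases Set.mem_uIcc.mp hzxy with h | h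
          · exact absurd (h2.2 hzS) (not_lt.mpr h.2)
          · exact absurd (h1.2 hzS) (not_lt.mpr h.2)
    · rintro ⟨I, ⟨z, ⟨-, hzA⟩, rfl⟩ | ⟨S, ⟨-, hS⟩, rfl⟩, hxI⟩
      · exact (show x = z from hxI) ▸ hzA
      · exact hS hxI
  rw [hAeq]
  refine isFiniteUnion_of_finite (Set.Finite.union (Set.Finite.image _ ?_)
    (Set.Finite.image _ ?_)) ?_
  · exact Z.finite_toSet.subset fun z hz => hz.1
  · exact Z.powerset.finite_toSet.subset fun S hS => hS.1
  · rintro I (⟨z, -, rfl⟩ | ⟨S, -, rfl⟩)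
    · exact Or.inl ⟨z, rfl⟩
    · exact Or.inr (isOpenInterval_cutInterval Z S)

theorem IsSemialgebraic.isFiniteUnion {A : Set (Fin 1 → ℝ)} (h : IsSemialgebraic A) :
    IsFiniteUnionOfPointsAndOpenIntervals {t : ℝ | (fun _ => t) ∈ A} := by
  classical
  obtain ⟨F, hF⟩ := isSemialgebraic_iff.mp h
  let P : MvPolynomial (Fin 1) ℝ →ₐ[ℝ] Polynomial ℝ := MvPolynomial.aeval fun _ => Polynomial.X
  have hP : ∀ f t, (P f).eval t = MvPolynomial.eval (fun _ => t) f := by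
    intro f t
    induction f using MvPolynomial.induction_on with
    | C r => simp [P]
    | add p q hp hq => simp [hp, hq]
    | mul_X p i hp => rw [map_mul, Polynomial.eval_mul, hp]; simp [P]
  refine isFiniteUnion_of_locally_constant (F.biUnion fun f => (P f).roots.toFinset) _ ?_
  intro x y hxy
  refine hF _ _ fun f hf => ?_
  rw [← hP, ← hP]
  -- The zero polynomial contributes no points to Z, but its sign is constant anyway.
  by_cases h0 : P f = 0
  · simp [h0]
  refine sign_eq_of_no_root (P f).continuous fun z hz hz0 => ?_
  exact hxy z (Finset.mem_biUnion.mpr ⟨f, hf, by simpa [h0] using hz0⟩) hz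

theorem isSemialgebraic_point (a : ℝ) : IsSemialgebraic {x : Fin 1 → ℝ | x 0 = a} :=
  isSemialgebraic_of_mem_iff_eq_zero (MvPolynomial.X 0 - MvPolynomial.C a)
    fun x => by simp [sub_eq_zero]

theorem isSemialgebraic_openInterval {I : Set ℝ} (h : IsOpenInterval I) :
    IsSemialgebraic {x : Fin 1 → ℝ | x 0 ∈ I} := by
  have hIoi : ∀ a : ℝ, IsSemialgebraic {x : Fin 1 → ℝ | x 0 ∈ Set.Ioi a} := fun a =>
    isSemialgebraic_of_mem_iff_pos (MvPolynomial.X 0 - MvPolynomial.C a) fun x => by simp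
  have hIio : ∀ a : ℝ, IsSemialgebraic {x : Fin 1 → ℝ | x 0 ∈ Set.Iio a} := fun a =>
    isSemialgebraic_of_mem_iff_pos (MvPolynomial.C a - MvPolynomial.X 0) fun x => by simp
  rcases h with ⟨a, b, rfl⟩ | ⟨a, rfl⟩ | ⟨b, rfl⟩ | rfl
  · exact (hIoi a).inter (hIio b)
  · exact hIoi a
  · exact hIio b
  · simpa using (isSemialgebraic_empty 1).compl

theorem isSemialgebraic_of_isFiniteUnion {A : Set (Fin 1 → ℝ)}
    (h : IsFiniteUnionOfPointsAndOpenIntervals {t : ℝ | (fun _ => t) ∈ A}) :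
    IsSemialgebraic A := by
  obtain ⟨k, J, hJ, hA⟩ := h
  have hAeq : A = ⋃ i, {x : Fin 1 → ℝ | x 0 ∈ J i} := by
    ext x
    have hx : (fun _ => x 0) = x := by ext i; rw [Subsingleton.elim i 0]
    have := Set.ext_iff.mp hA (x 0)
    rw [Set.mem_ofPred_eq, hx] at this
    simpa using this
  rw [hAeq]
  refine IsSemialgebraic.iUnion fun i => ?_
  rcases hJ i with ⟨a, ha⟩ | hI
  · simpa [ha] using isSemialgebraic_point a
  · exact isSemialgebraic_openInterval hI

theorem mainTheorem2 :
    IsOMinimalStructure (fun n : ℕ => {X : Set (Fin n → ℝ) | IsSemialgebraic X}) where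
  empty_mem := isSemialgebraic_empty
  union_mem _ _ _ hA hB := IsSemialgebraic.union hA hB
  compl_mem _ _ hA := IsSemialgebraic.compl hA
  prod_right_mem _ _ hA := IsSemialgebraic.preimage_comp hA Fin.castSucc
  prod_left_mem _ _ hA := IsSemialgebraic.preimage_comp hA Fin.succ
  diagonal_mem _ i j _ :=
    isSemialgebraic_of_mem_iff_eq_zero (MvPolynomial.X i - MvPolynomial.X j)
      fun x => by simp [sub_eq_zero]
  projection_mem _ _ hA := IsSemialgebraic.projection hA
  point_mem a := by
    have : ({fun _ => a} : Set (Fin 1 → ℝ)) = {x | x 0 = a} := by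
      ext x
      rw [Set.mem_singleton_iff, Set.mem_ofPred_eq, funext_iff, Fin.forall_fin_one]
    rw [this]
    exact isSemialgebraic_point a
  lt_mem :=
    isSemialgebraic_of_mem_iff_pos (MvPolynomial.X 1 - MvPolynomial.X 0) fun x => by simp
  mem_one_iff _ := ⟨IsSemialgebraic.isFiniteUnion, isSemialgebraic_of_isFiniteUnion⟩
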